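/- Let $X$ be a real Banach space with $\dim X\ge 2$. For $\varepsilon\in[0,2]$ and $t\in[0,1]$ let $$\delta_X(\varepsilon,t)=\inf\{1-\|tx+(1-t)y\| : x,y\in X,\ \|x\|=\|y\|=1,\ \|x-y\|=\varepsilon\}$$ be the generalized modulus of convexity and $$\delta^+_X(\varepsilon,t)=\sup\{1-\|tx+(1-t)y\| : x,y\in X,\ \|x\|=\|y\|=1,\ \|x-y\|=\varepsilon\}$$ the generalized Banaś modulus. Then for every real Hilbert space $H$ with $\dim H\ge 2$, every $\varepsilon\in[0,2]$ and every $t\in[0,1]$, $$\delta_X(\varepsilon,t)\le \delta_H(\varepsilon,t)=1-\sqrt{1-t(1-t)\varepsilon^2}=\delta^+_H(\varepsilon,t)\le \delta^+_X(\varepsilon,t).$$ -/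

import Mathlib

/-- The values `1 - ‖t x + (1 - t) y‖`, where `x, y` run over the pairs of unit vectors of `X`
with `‖x - y‖ = ε`. -/
def chordDefects (X : Type*) [NormedAddCommGroup X] [NormedSpace ℝ X] (ε t : ℝ) : Set ℝ :=
  {r : ℝ | ∃ x y : X, ‖x‖ = 1 ∧ ‖y‖ = 1 ∧ ‖x - y‖ = ε ∧ r = 1 - ‖t • x + (1 - t) • y‖}

/-- The generalized modulus of convexity `δ_X(ε, t)`. -/
noncomputable def genConvexityModulus (X : Type*) [NormedAddCommGroup X] [NormedSpace ℝ X]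
    (ε t : ℝ) : ℝ :=
  sInf (chordDefects X ε t)

/-- The generalized Banaś modulus `δ⁺_X(ε, t)`. -/
noncomputable def genBanasModulus (X : Type*) [NormedAddCommGroup X] [NormedSpace ℝ X]
    (ε t : ℝ) : ℝ :=
  sSup (chordDefects X ε t)

/-! In a Hilbert space the parallelogram law gives `‖t x + (1 - t) y‖² = 1 - t (1 - t) ε²` for every
chord of length `ε`. It remains to find, in any plane of `X`, one chord of length `ε` whose dividing
point has norm at most `√(1 - t (1 - t) ε²)` and one where it is at least that.

Let the planar norm be strictly convex with a C¹ unit circle `γ`. At a pair of angles `(α, β)` the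
maps `t γ(α) + (1 - t) γ(β)` and `γ(β) - γ(α)` have Jacobians `t (1 - t) γ'(α) ∧ γ'(β)` and `-γ'(α)
∧ γ'(β)`. On positively oriented pairs the first map is injective (`eq_of_convexCombination_eq`),
while the second covers all vectors of norm strictly between 0 and 2 (`mem_image_comb`). So the
dividing points fill at least `t (1 - t)` times the area of the set of chord vectors
(`volume_image_comb`, `area_comparison`).

Suppose all chords of length `ε` had dividing points of norm greater than `√(1 - t (1 - t) ε²)`. The
dividing-point map is open, so the least norm `m` over chords of length at most `ε` is attained at
length `ε` or at `x = y`, and `m` also exceeds this bound. All these dividing points lie in the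
annulus between `m` and 1, so `t (1 - t) ε² ≤ 1 - m²`, a contradiction. Chords of length at least
`ε` and the greatest norm give the other inequality.

An arbitrary planar norm is a limit of such regular norms, and compactness carries the chords to the
limit. -/

open MeasureTheory Filter Topology Pointwise

/-! ### Regular planar norms and their unit circles -/

/-- The standard area form of the plane `ℂ`. -/
def wedge (u v : ℂ) : ℝ := u.re * v.im - u.im * v.re

/-- A norm on `ℂ` with strictly convex unit ball whose restriction to the Euclidean unit circle is
continuously differentiable as a function of the angle. -/
structure RegularPlaneNorm where
  M : Seminorm ℝ ℂ
  radial : ℝ → ℝ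
  radial' : ℝ → ℝ
  hasDerivAt_radial : ∀ θ, HasDerivAt radial (radial' θ) θ
  continuous_radial' : Continuous radial'
  radial_pos : ∀ θ, 0 < radial θ
  M_exp : ∀ θ : ℝ, M (Complex.exp (θ * Complex.I)) = radial θ
  strict : ∀ x y : ℂ, M x ≤ 1 → M y ≤ 1 → x ≠ y → ∀ a b : ℝ, 0 < a → 0 < b → a + b = 1 →
    M (a • x + b • y) < 1

namespace RegularPlaneNorm

variable (S : RegularPlaneNorm)

theorem continuous_M : Continuous S.M := by
  have := S.M.convexOn.locallyLipschitz
  exact this.continuous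

theorem continuous_radial : Continuous S.radial :=
  continuous_iff_continuousAt.2 fun θ => (S.hasDerivAt_radial θ).continuousAt

theorem M_eq (x : ℂ) : S.M x = ‖x‖ * S.radial x.arg := by
  have h : x = ‖x‖ • Complex.exp (x.arg * Complex.I) := by
    rw [Complex.real_smul, Complex.norm_mul_exp_arg_mul_I]
  conv_lhs => rw [h]
  rw [map_smul_eq_mul, S.M_exp, norm_norm]

theorem M_pos {x : ℂ} (hx : x ≠ 0) : 0 < S.M x := by
  rw [S.M_eq]
  exact mul_pos (norm_pos_iff.2 hx) (S.radial_pos _)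

theorem M_smul (a : ℝ) (x : ℂ) : S.M (a • x) = |a| * S.M x := by
  rw [map_smul_eq_mul, Real.norm_eq_abs]

/-- The unit circle parametrized by the angle. -/
noncomputable def γ (θ : ℝ) : ℂ := (S.radial θ)⁻¹ • Complex.exp (θ * Complex.I)

/-- The velocity of `γ`. -/
noncomputable def γ' (θ : ℝ) : ℂ :=
  (S.radial θ)⁻¹ • (Complex.exp (θ * Complex.I) * Complex.I) +
    (-S.radial' θ / S.radial θ ^ 2) • Complex.exp (θ * Complex.I)

theorem hasDerivAt_γ (θ : ℝ) : HasDerivAt S.γ (S.γ' θ) θ := by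
  have h1 : HasDerivAt (fun θ : ℝ => Complex.exp (θ * Complex.I))
      (Complex.exp (θ * Complex.I) * Complex.I) θ := by
    have := ((Complex.ofRealCLM.hasDerivAt (x := θ)).mul_const Complex.I).cexp
    simpa using this
  exact ((S.hasDerivAt_radial θ).inv (S.radial_pos θ).ne').smul h1

theorem continuous_γ : Continuous S.γ :=
  continuous_iff_continuousAt.2 fun θ => (S.hasDerivAt_γ θ).continuousAt

theorem continuous_γ' : Continuous S.γ' := by
  have h := S.continuous_radial
  have h' := S.continuous_radial'
  have h0 : ∀ θ, S.radial θ ≠ 0 := fun θ => (S.radial_pos θ).ne'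
  have h2 : ∀ θ, S.radial θ ^ 2 ≠ 0 := fun θ => pow_ne_zero _ (h0 θ)
  unfold γ'
  exact ((h.inv₀ h0).smul (by fun_prop)).add ((h'.neg.div (h.pow 2) h2).smul (by fun_prop))

theorem hasStrictDerivAt_γ (θ : ℝ) : HasStrictDerivAt S.γ (S.γ' θ) θ :=
  hasStrictDerivAt_of_hasDerivAt_of_continuousAt
    (Filter.Eventually.of_forall S.hasDerivAt_γ) S.continuous_γ'.continuousAt

theorem M_γ (θ : ℝ) : S.M (S.γ θ) = 1 := by
  rw [γ, M_smul, S.M_exp, abs_of_pos (inv_pos.2 (S.radial_pos θ)),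
    inv_mul_cancel₀ (S.radial_pos θ).ne']

theorem wedge_γ (α β : ℝ) :
    wedge (S.γ α) (S.γ β) = (S.radial α)⁻¹ * (S.radial β)⁻¹ * Real.sin (β - α) := by
  simp only [wedge, γ, Complex.real_smul, Complex.re_ofReal_mul, Complex.im_ofReal_mul,
    Complex.exp_ofReal_mul_I_re, Complex.exp_ofReal_mul_I_im, Real.sin_sub]
  ring

theorem wedge_γ_pos {α β : ℝ} (h : α < β) (h' : β < α + Real.pi) :
    0 < wedge (S.γ α) (S.γ β) := by
  rw [wedge_γ]
  exact mul_pos (mul_pos (inv_pos.2 (S.radial_pos _)) (inv_pos.2 (S.radial_pos _)))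
    (Real.sin_pos_of_pos_of_lt_pi (by linarith) (by linarith))

theorem wedge_γ_γ' (θ : ℝ) : wedge (S.γ θ) (S.γ' θ) = (S.radial θ)⁻¹ ^ 2 := by
  simp only [wedge, γ, γ', Complex.real_smul,
    Complex.exp_ofReal_mul_I_re, Complex.exp_ofReal_mul_I_im, Complex.add_re, Complex.add_im,
    Complex.mul_re, Complex.mul_im, Complex.I_re, Complex.I_im, Complex.ofReal_re,
    Complex.ofReal_im]
  linear_combination (S.radial θ)⁻¹ ^ 2 * Real.sin_sq_add_cos_sq θ

theorem γ_injOn {α β : ℝ} (h : S.γ α = S.γ β) (hd : |α - β| < 2 * Real.pi) : α = β := by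
  have hn : ∀ θ, ‖S.γ θ‖ = (S.radial θ)⁻¹ := fun θ => by
    rw [γ, norm_smul, Complex.norm_exp_ofReal_mul_I, mul_one, Real.norm_eq_abs,
      abs_of_pos (inv_pos.2 (S.radial_pos θ))]
  have hr : (S.radial α)⁻¹ = (S.radial β)⁻¹ := by rw [← hn, ← hn, h]
  have he : Complex.exp (α * Complex.I) = Complex.exp (β * Complex.I) := by
    have h2 := h
    rw [γ, γ, hr] at h2
    exact smul_right_injective ℂ (inv_pos.2 (S.radial_pos β)).ne' h2
  obtain ⟨n, hn⟩ := Complex.exp_eq_exp_iff_exists_int.1 he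
  have h3 : α = β + n * (2 * Real.pi) := by
    have := congrArg Complex.im hn
    simpa using this
  have h4 : |(n : ℝ)| * (2 * Real.pi) < 1 * (2 * Real.pi) := by
    have : α - β = n * (2 * Real.pi) := by linarith
    rw [this, abs_mul, abs_of_pos Real.two_pi_pos] at hd
    linarith
  have h5 : |(n : ℝ)| < 1 := lt_of_mul_lt_mul_right h4 Real.two_pi_pos.le
  have h6 : n = 0 := by
    rw [← Int.cast_abs] at h5
    exact Int.abs_lt_one_iff.1 (by exact_mod_cast h5)
  rw [h3, h6]; simp

theorem exists_angles {x y : ℂ} (hx : S.M x = 1) (hy : S.M y = 1) (hxy : 0 < wedge x y) :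
    ∃ α β : ℝ, α ∈ Set.Ioc (-Real.pi) Real.pi ∧ α < β ∧ β < α + Real.pi ∧
      S.γ α = x ∧ S.γ β = y := by
  have hx0 : x ≠ 0 := by rintro rfl; simp at hx
  have hy0 : y ≠ 0 := by rintro rfl; simp at hy
  have key : ∀ (v : ℂ) (θ : ℝ), v ≠ 0 → S.M v = 1 → Complex.exp (θ * Complex.I) = v / ‖v‖ →
      S.γ θ = v := by
    intro v θ hv hMv he
    have hv' : ‖v‖ ≠ 0 := norm_ne_zero_iff.2 hv
    have : S.radial θ = ‖v‖⁻¹ := by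
      rw [← S.M_exp, he]
      have : v / (‖v‖ : ℂ) = ‖v‖⁻¹ • v := by
        rw [Complex.real_smul]; push_cast; field_simp
      rw [this, M_smul, hMv]; simp
    have hv'' : (‖v‖ : ℂ) ≠ 0 := by exact_mod_cast hv'
    rw [γ, this, he, inv_inv, Complex.real_smul, mul_div_cancel₀ _ hv'']
  have ea : ∀ v : ℂ, v ≠ 0 → Complex.exp (v.arg * Complex.I) = v / ‖v‖ := by
    intro v hv
    have hv' : (‖v‖ : ℂ) ≠ 0 := by exact_mod_cast norm_ne_zero_iff.2 hv
    rw [eq_div_iff hv', mul_comm, Complex.norm_mul_exp_arg_mul_I]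
  have him : 0 < (y / x).im := by
    rw [Complex.div_im]
    have : 0 < Complex.normSq x := Complex.normSq_pos.2 hx0
    rw [← sub_div]
    apply div_pos _ this
    unfold wedge at hxy; linarith
  have h1 : 0 < (y / x).arg := by
    refine lt_of_le_of_ne (Complex.arg_nonneg_iff.2 him.le) fun h => ?_
    have := (Complex.arg_eq_zero_iff.1 h.symm).2
    linarith
  have h2 : (y / x).arg < Real.pi := by
    refine lt_of_le_of_ne (Complex.arg_le_pi _) fun h => ?_
    have := (Complex.arg_eq_pi_iff.1 h).2
    linarith
  refine ⟨x.arg, x.arg + (y / x).arg, ⟨Complex.neg_pi_lt_arg x, Complex.arg_le_pi x⟩,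
    by linarith, by linarith, key x _ hx0 hx (ea x hx0), key y _ hy0 hy ?_⟩
  rw [Complex.ofReal_add, add_mul, Complex.exp_add, ea x hx0, ea _ (div_ne_zero hy0 hx0), norm_div]
  have hx' : (‖x‖ : ℂ) ≠ 0 := by exact_mod_cast norm_ne_zero_iff.2 hx0
  have hy' : (‖y‖ : ℂ) ≠ 0 := by exact_mod_cast norm_ne_zero_iff.2 hy0
  push_cast
  field_simp

/-! ### Support functionals and tangents -/

theorem exists_support {x : ℂ} (hx : S.M x = 1) :
    ∃ F : ℂ →ₗ[ℝ] ℝ, F x = 1 ∧ ∀ v, F v ≤ S.M v := by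
  have hx0 : x ≠ 0 := by rintro rfl; simp at hx
  obtain ⟨F, h1, h2⟩ := exists_extension_of_le_sublinear
    (LinearPMap.mkSpanSingleton (K := ℝ) x (1 : ℝ) hx0) S.M
    (fun c hc v => by rw [M_smul, abs_of_pos hc]) (map_add_le_add S.M) (by
      rintro ⟨v, hv⟩
      obtain ⟨c, rfl⟩ := Submodule.mem_span_singleton.1 hv
      refine (LinearPMap.mkSpanSingleton'_apply x (1 : ℝ) _ c hv).trans_le ?_
      simp only [M_smul, hx, smul_eq_mul, mul_one]
      exact le_abs_self c)
  have h3 : (1 : ℝ) • x ∈ (LinearPMap.mkSpanSingleton x (1 : ℝ) hx0 : ℂ →ₗ.[ℝ] ℝ).domain :=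
    Submodule.smul_mem _ _ (Submodule.mem_span_singleton_self (R := ℝ) x)
  have h4 := (h1 ⟨(1 : ℝ) • x, h3⟩).trans
    (LinearPMap.mkSpanSingleton'_apply x (1 : ℝ) _ (1 : ℝ) h3)
  exact ⟨F, by simpa using h4, h2⟩

theorem support_γ' {F : ℂ →ₗ[ℝ] ℝ} {θ : ℝ} (h1 : F (S.γ θ) = 1) (h2 : ∀ v, F v ≤ S.M v) :
    F (S.γ' θ) = 0 := by
  have hd : HasDerivAt (fun s => F (S.γ s)) (F (S.γ' θ)) θ :=
    (LinearMap.toContinuousLinearMap F).hasFDerivAt.comp_hasDerivAt θ (S.hasDerivAt_γ θ)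
  refine IsLocalMax.hasDerivAt_eq_zero (Filter.Eventually.of_forall fun s => ?_) hd
  rw [h1]
  exact (h2 _).trans_eq (S.M_γ s)

theorem γ'_ne_zero (θ : ℝ) : S.γ' θ ≠ 0 := by
  intro h
  have := S.wedge_γ_γ' θ
  rw [h] at this
  have h2 := pow_pos (inv_pos.2 (S.radial_pos θ)) 2
  rw [← this] at h2
  simp [wedge] at h2

theorem eq_of_support {F : ℂ →ₗ[ℝ] ℝ} (hF : ∀ v, F v ≤ S.M v) {x y : ℂ} (hx : S.M x = 1)
    (hy : S.M y = 1) (hFx : F x = 1) (hFy : F y = 1) : x = y := by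
  by_contra hne
  have h := S.strict x y hx.le hy.le hne (1 / 2) (1 / 2) (by norm_num) (by norm_num) (by norm_num)
  have h2 := hF ((1 / 2 : ℝ) • x + (1 / 2 : ℝ) • y)
  rw [map_add, map_smul, map_smul, hFx, hFy] at h2
  norm_num at h2 h
  linarith

/-- Parallel tangents would make the support functionals at the two points proportional. By strict
convexity the points would then be equal or opposite, which positive orientation excludes. -/
theorem wedge_γ'_ne_zero {α β : ℝ} (h : 0 < wedge (S.γ α) (S.γ β)) :
    wedge (S.γ' α) (S.γ' β) ≠ 0 := by
  intro h0
  obtain ⟨F, hF1, hF⟩ := S.exists_support (S.M_γ α)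
  obtain ⟨G, hG1, hG⟩ := S.exists_support (S.M_γ β)
  have hF0 := S.support_γ' hF1 hF
  have hG0 := S.support_γ' hG1 hG
  have expand : ∀ (L : ℂ →ₗ[ℝ] ℝ) (v : ℂ), L v = v.re * L 1 + v.im * L Complex.I := by
    intro L v
    have : v = v.re • (1 : ℂ) + v.im • Complex.I := by
      simp [Complex.re_add_im]
    conv_lhs => rw [this]
    simp only [map_add, map_smul, smul_eq_mul]
  have hGα : G (S.γ' α) = 0 := by
    rw [expand] at hG0 ⊢
    have hne := S.γ'_ne_zero β
    unfold wedge at h0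
    by_cases hre : (S.γ' β).re = 0
    · have him : (S.γ' β).im ≠ 0 := fun him => hne (Complex.ext hre him)
      apply mul_left_cancel₀ him
      linear_combination (S.γ' α).im * hG0 + G 1 * h0
    · apply mul_left_cancel₀ hre
      linear_combination (S.γ' α).re * hG0 - G Complex.I * h0
  have hαα : 0 < wedge (S.γ α) (S.γ' α) := by
    rw [wedge_γ_γ']; exact pow_pos (inv_pos.2 (S.radial_pos α)) 2
  -- Both functionals vanish on `γ' α`, which spans the plane together with `γ α`.
  have hprop : ∀ v, G v = G (S.γ α) * F v := by
    intro v
    apply mul_left_cancel₀ hαα.ne'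
    rw [expand] at hGα hF0 hF1
    rw [expand G, expand F v, expand G (S.γ α)]
    unfold wedge
    grind
  have hneg : ∀ (L : ℂ →ₗ[ℝ] ℝ), (∀ v, L v ≤ S.M v) → ∀ v, |L v| ≤ S.M v := by
    intro L hL v
    refine abs_le.2 ⟨?_, hL v⟩
    have := hL (-v)
    rw [map_neg, map_neg_eq_map] at this
    linarith
  have h1 := hprop (S.γ β)
  rw [hG1] at h1
  have hFb := hneg F hF (S.γ β)
  have hGa := hneg G hG (S.γ α)
  rw [S.M_γ] at hFb hGa
  -- The product of `G (γ α)` and `F (γ β)` is 1 and neither exceeds 1 in absolute value.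
  have habs : |F (S.γ β)| = 1 := by
    have : 1 = |G (S.γ α)| * |F (S.γ β)| := by rw [← abs_mul, ← h1, abs_one]
    nlinarith [abs_nonneg (F (S.γ β)), abs_nonneg (G (S.γ α))]
  rcases eq_or_eq_neg_of_abs_eq habs with h2 | h2
  · have := S.eq_of_support hF (S.M_γ α) (S.M_γ β) hF1 h2
    rw [this] at h
    unfold wedge at h
    linarith
  · have := S.eq_of_support hF (S.M_γ α) (y := -S.γ β) (by rw [map_neg_eq_map, S.M_γ]) hF1
      (by rw [map_neg, h2, neg_neg])
    rw [this] at h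
    simp only [wedge, Complex.neg_re, Complex.neg_im] at h
    linarith

/-! ### Strict convexity and uniqueness of the chord through a dividing point -/

theorem mem_Icc_of_line {x d : ℂ} (hx : S.M x = 1) (hxd : S.M (x + d) = 1) (hd : d ≠ 0) {s : ℝ}
    (hs : S.M (x + s • d) ≤ 1) : s ∈ Set.Icc (0 : ℝ) 1 := by
  constructor
  -- For `s < 0` the point `x` lies strictly between `x + s d` and `x + d`, so its norm would be
  -- less than 1. The case `s > 1` is the same with `x + d` in the middle.
  · by_contra! h
    have h1 : 0 < 1 - s := by linarith
    have := S.strict (x + d) (x + s • d) hxd.le hs (by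
        intro he
        have h2 : (1 - s) • d = 0 := by
          rw [sub_smul, one_smul, sub_eq_zero]; exact add_left_cancel he
        rcases smul_eq_zero.1 h2 with h3 | h3
        · linarith
        · exact hd h3) (-s / (1 - s)) (1 / (1 - s)) (div_pos (by linarith) h1)
        (div_pos one_pos h1) (by field_simp; ring)
    have he : (-s / (1 - s)) • (x + d) + (1 / (1 - s)) • (x + s • d) = x := by
      match_scalars <;> field_simp
      all_goals ring
    rw [he, hx] at this
    exact lt_irrefl _ this
  · by_contra! h
    have h1 : 0 < s := by linarith
    have := S.strict x (x + s • d) hx.le hs (by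
        intro he
        have h2 : s • d = 0 := by simpa using he.symm
        rcases smul_eq_zero.1 h2 with h3 | h3
        · linarith
        · exact hd h3) ((s - 1) / s) (1 / s) (div_pos (by linarith) h1)
        (div_pos one_pos h1) (by field_simp; ring)
    have he : ((s - 1) / s) • x + (1 / s) • (x + s • d) = x + d := by
      match_scalars <;> field_simp
      ring
    rw [he, hxd] at this
    exact lt_irrefl _ this

end RegularPlaneNorm

theorem exists_smul_of_wedge_eq_zero {d v : ℂ} (hd : d ≠ 0) (h : wedge d v = 0) :
    ∃ s : ℝ, v = s • d := by
  unfold wedge at h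
  by_cases hre : d.re = 0
  · have him : d.im ≠ 0 := fun him => hd (Complex.ext hre him)
    refine ⟨v.im / d.im, Complex.ext ?_ ?_⟩
    · rw [hre] at h
      have : v.re = 0 := by
        apply mul_left_cancel₀ him
        linarith
      simp [hre, this]
    · simp [him]
  · refine ⟨v.re / d.re, Complex.ext ?_ ?_⟩
    · simp [hre]
    · simp only [Complex.smul_im, smul_eq_mul]
      field_simp
      linarith

namespace RegularPlaneNorm

variable (S : RegularPlaneNorm)

/-- The chords `[x, x + d]` and `[y - k d, y]` are parallel, and `|wedge d ·|` measures the distance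
of their lines from the origin. Scaling the second chord by `l`, with `|l| ≤ 1`, moves it onto the
line of the first and keeps it in the unit ball, hence inside the first chord. The two wedges can
then be read off from the positions on that line. -/
theorem wedge_mul_wedge_nonpos {x y d : ℂ} {k : ℝ} (hx : S.M x = 1) (hxd : S.M (x + d) = 1)
    (hd : d ≠ 0) (hy : S.M y = 1) (hyd : S.M (y - k • d) = 1) (hp : wedge d x ≠ 0)
    (hq : wedge d y ≠ 0) (hpq : |wedge d x| ≤ |wedge d y|) :
    wedge x y * wedge (x + d) (y - k • d) ≤ 0 := by
  set l := wedge d x / wedge d y with hl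
  have hl0 : l ≠ 0 := div_ne_zero hp hq
  have hl1 : |l| ≤ 1 := by
    rw [hl, abs_div]
    exact div_le_one_of_le₀ hpq (abs_nonneg _)
  have hlq : l * wedge d y = wedge d x := div_mul_cancel₀ _ hq
  obtain ⟨s, hs⟩ := exists_smul_of_wedge_eq_zero (v := l • y - x) hd (by
    have : wedge d (l • y - x) = l * wedge d y - wedge d x := by
      simp only [wedge, Complex.sub_re, Complex.sub_im, Complex.smul_re, Complex.smul_im,
        smul_eq_mul]
      ring
    rw [this, hlq, sub_self])
  have h1 : l • y = x + s • d := by rw [← hs]; abel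
  have h2 : l • (y - k • d) = x + (s - l * k) • d := by
    rw [smul_sub, h1]; module
  have m1 := S.mem_Icc_of_line hx hxd hd (s := s) (by rw [← h1, M_smul, hy, mul_one]; exact hl1)
  have m2 := S.mem_Icc_of_line hx hxd hd (s := s - l * k)
    (by rw [← h2, M_smul, hyd, mul_one]; exact hl1)
  have e1 : l * wedge x y = -(s * wedge d x) := by
    have : l * wedge x y = wedge x (l • y) := by
      simp only [wedge, Complex.smul_re, Complex.smul_im, smul_eq_mul]; ring
    rw [this, h1]
    simp only [wedge, Complex.add_re, Complex.add_im, Complex.smul_re, Complex.smul_im,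
      smul_eq_mul]
    ring
  have e2 : l * wedge (x + d) (y - k • d) = (1 - (s - l * k)) * wedge d x := by
    have : l * wedge (x + d) (y - k • d) = wedge (x + d) (l • (y - k • d)) := by
      simp only [wedge, Complex.smul_re, Complex.smul_im, smul_eq_mul]; ring
    rw [this, h2]
    simp only [wedge, Complex.add_re, Complex.add_im, Complex.smul_re, Complex.smul_im,
      smul_eq_mul]
    ring
  have e3 : l ^ 2 * (wedge x y * wedge (x + d) (y - k • d)) =
      -(s * (1 - (s - l * k)) * wedge d x ^ 2) := by
    linear_combination l * wedge (x + d) (y - k • d) * e1 - s * wedge d x * e2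
  have e4 : 0 ≤ s * (1 - (s - l * k)) * wedge d x ^ 2 :=
    mul_nonneg (mul_nonneg m1.1 (by linarith [m2.2])) (sq_nonneg _)
  have e5 : 0 < l ^ 2 := by positivity
  by_contra! hcon
  have := mul_pos e5 hcon
  linarith

/-- Here `x + d` is a multiple of `x` of norm 1, and the orientation hypothesis excludes `-x`. -/
theorem eq_zero_of_parallel {x y d : ℂ} {k : ℝ} (hx : S.M x = 1) (hxd : S.M (x + d) = 1)
    (hw : 0 < wedge x y * wedge (x + d) (y - k • d)) (hp : wedge d x = 0) : d = 0 := by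
  have hx0 : x ≠ 0 := by rintro rfl; simp at hx
  have hp' : wedge x d = 0 := by unfold wedge at hp ⊢; linarith
  obtain ⟨c, rfl⟩ := exists_smul_of_wedge_eq_zero hx0 hp'
  have h1 : x + c • x = (1 + c) • x := by module
  rw [h1, M_smul, hx, mul_one] at hxd
  have h2 : wedge x y * wedge (x + c • x) (y - k • c • x) = (1 + c) * wedge x y ^ 2 := by
    simp only [wedge, Complex.add_re, Complex.add_im, Complex.sub_re, Complex.sub_im,
      Complex.smul_re, Complex.smul_im, smul_eq_mul]
    ring
  rw [h2] at hw
  have h3 : 0 < 1 + c := pos_of_mul_pos_left hw (sq_nonneg _)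
  rw [abs_of_pos h3] at hxd
  have : c = 0 := by linarith
  rw [this, zero_smul]

theorem eq_of_convexCombination_eq {t : ℝ} (ht0 : 0 < t) (ht1 : t < 1) {x y x' y' : ℂ}
    (hx : S.M x = 1) (hy : S.M y = 1) (hx' : S.M x' = 1) (hy' : S.M y' = 1)
    (hxy : 0 < wedge x y) (hxy' : 0 < wedge x' y')
    (hz : t • x + (1 - t) • y = t • x' + (1 - t) • y') : x = x' ∧ y = y' := by
  have ht2 : 0 < 1 - t := by linarith
  obtain ⟨d, rfl⟩ : ∃ d, x' = x + d := ⟨x' - x, by abel⟩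
  obtain ⟨k, hk, hk'⟩ : ∃ k : ℝ, 0 < k ∧ t = (1 - t) * k :=
    ⟨t / (1 - t), div_pos ht0 ht2, by field_simp⟩
  have hyd : y' = y - k • d := by
    have h1 : (1 - t) • y' = (1 - t) • (y - k • d) := by
      rw [smul_sub, smul_smul, ← hk']
      have : (1 - t) • y' = t • x + (1 - t) • y - t • (x + d) := by rw [hz]; abel
      rw [this]; module
    exact smul_right_injective ℂ ht2.ne' h1
  subst hyd
  have hw := mul_pos hxy hxy'
  suffices hd : d = 0 by simp [hd]
  by_contra hd
  have hd2 : x - k⁻¹ • (-k) • d = x + d := by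
    rw [smul_smul, mul_neg, inv_mul_cancel₀ hk.ne', neg_one_smul, sub_neg_eq_add]
  have hd3 : y + (-k) • d = y - k • d := by module
  have swap : wedge y x * wedge (y + (-k) • d) (x - k⁻¹ • (-k) • d) =
      wedge x y * wedge (x + d) (y - k • d) := by
    rw [hd2, hd3]
    simp only [wedge]
    ring
  have hdk : (-k) • d ≠ 0 := smul_ne_zero (neg_ne_zero.2 hk.ne') hd
  have hwd : ∀ v, wedge ((-k) • d) v = -k * wedge d v := fun v => by
    simp only [wedge, Complex.smul_re, Complex.smul_im, smul_eq_mul]; ring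
  have hp : wedge d x ≠ 0 := fun h => hd (S.eq_zero_of_parallel hx hx' hw h)
  have hq : wedge d y ≠ 0 := fun h => hdk
    (S.eq_zero_of_parallel hy (by rw [hd3]; exact hy') (k := k⁻¹) (by rw [swap]; exact hw)
      (by rw [hwd, h, mul_zero]))
  -- The chord on the line nearer to the origin has to come first. Exchanging `x` and `y` replaces
  -- `d` by `-k d` and `k` by `k⁻¹`.
  rcases le_total |wedge d x| |wedge d y| with hle | hle
  · exact absurd (S.wedge_mul_wedge_nonpos hx hx' hd hy hy' hp hq hle) (not_le.2 hw)
  · have := S.wedge_mul_wedge_nonpos (x := y) (y := x) (d := (-k) • d) (k := k⁻¹) hy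
      (by rw [hd3]; exact hy') hdk hx (by rw [hd2]; exact hx')
      (by rw [hwd]; exact mul_ne_zero (neg_ne_zero.2 hk.ne') hq)
      (by rw [hwd]; exact mul_ne_zero (neg_ne_zero.2 hk.ne') hp)
      (by rw [hwd, hwd, abs_mul, abs_mul]; exact mul_le_mul_of_nonneg_left hle (abs_nonneg _))
    rw [swap] at this
    exact absurd this (not_le.2 hw)

/-! ### Combinations of two circle points: Jacobian and openness -/

/-- The linear combination of the two points of the unit circle whose angles are the real and the
imaginary part of `p`. -/
noncomputable def comb (s r : ℝ) (p : ℂ) : ℂ := s • S.γ p.re + r • S.γ p.im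

/-- The derivative of `comb`. -/
noncomputable def combDeriv (s r : ℝ) (p : ℂ) : ℂ →L[ℝ] ℂ :=
  s • Complex.reCLM.smulRight (S.γ' p.re) + r • Complex.imCLM.smulRight (S.γ' p.im)

theorem hasStrictFDerivAt_comb (s r : ℝ) (p : ℂ) :
    HasStrictFDerivAt (S.comb s r) (S.combDeriv s r p) p := by
  have h1 := (S.hasStrictDerivAt_γ p.re).hasStrictFDerivAt.comp p
    (Complex.reCLM.hasStrictFDerivAt (x := p))
  have h2 := (S.hasStrictDerivAt_γ p.im).hasStrictFDerivAt.comp p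
    (Complex.imCLM.hasStrictFDerivAt (x := p))
  have he : S.combDeriv s r p =
      s • (ContinuousLinearMap.toSpanSingleton ℝ (S.γ' p.re)).comp Complex.reCLM +
        r • (ContinuousLinearMap.toSpanSingleton ℝ (S.γ' p.im)).comp Complex.imCLM := by
    ext <;> simp [combDeriv]
  rw [he]
  exact (h1.const_smul s).add (h2.const_smul r)

theorem det_combDeriv (s r : ℝ) (p : ℂ) :
    (S.combDeriv s r p).det = s * r * wedge (S.γ' p.re) (S.γ' p.im) := by
  rw [ContinuousLinearMap.det, ← LinearMap.det_toMatrix Complex.basisOneI, Matrix.det_fin_two]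
  simp only [LinearMap.toMatrix_apply, Complex.coe_basisOneI, Complex.coe_basisOneI_repr]
  simp [combDeriv, wedge]
  ring

theorem map_comb_nhds {s r : ℝ} (hs : s ≠ 0) (hr : r ≠ 0) {p : ℂ}
    (hp : 0 < wedge (S.γ p.re) (S.γ p.im)) :
    map (S.comb s r) (𝓝 p) = 𝓝 (S.comb s r p) := by
  refine (S.hasStrictFDerivAt_comb s r p).map_nhds_eq_of_surj ?_
  have hdet : (S.combDeriv s r p).det ≠ 0 := by
    rw [det_combDeriv]
    exact mul_ne_zero (mul_ne_zero hs hr) (S.wedge_γ'_ne_zero hp)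
  have hu : IsUnit ((S.combDeriv s r p : ℂ →L[ℝ] ℂ) : ℂ →ₗ[ℝ] ℂ) :=
    (LinearMap.isUnit_iff_isUnit_det _).2 (isUnit_iff_ne_zero.2 hdet)
  exact (LinearMap.isUnit_iff_range_eq_top _).1 hu

theorem exists_comb_lt_and_exists_comb_gt {s r : ℝ} (hs : s ≠ 0) (hr : r ≠ 0) {p : ℂ}
    (hp : 0 < wedge (S.γ p.re) (S.γ p.im)) {U : Set ℂ} (hU : U ∈ 𝓝 p) :
    (∃ q ∈ U, S.M (S.comb s r q) < S.M (S.comb s r p)) ∧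
      ∃ q ∈ U, S.M (S.comb s r p) < S.M (S.comb s r q) := by
  set z := S.comb s r p with hz
  have hz0 : z ≠ 0 := by
    intro h0
    have h1 : s * wedge (S.γ p.re) (S.γ p.im) = wedge z (S.γ p.im) := by
      simp only [hz, comb, wedge, Complex.add_re, Complex.add_im, Complex.smul_re,
        Complex.smul_im, smul_eq_mul]
      ring
    rw [h0] at h1
    have h2 : wedge 0 (S.γ p.im) = 0 := by simp [wedge]
    rw [h2] at h1
    exact mul_ne_zero hs hp.ne' h1
  have hzp := S.M_pos hz0
  have himg : S.comb s r '' U ∈ 𝓝 z := by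
    rw [hz, ← S.map_comb_nhds hs hr hp]; exact image_mem_map hU
  have hlim : Tendsto (fun c : ℝ => c • z) (𝓝 1) (𝓝 z) := by
    have : Continuous fun c : ℝ => c • z := by fun_prop
    simpa using this.tendsto 1
  have hev := hlim.eventually himg
  obtain ⟨δ, hδ, hball⟩ := Metric.eventually_nhds_iff.1 hev
  -- The image of `U` contains `c z` for all `c` near 1. The cap at 1 keeps the factor `1 - min (δ /
  -- 2) 1` nonnegative.
  have hmin : 0 < min (δ / 2) 1 := by positivity
  have hm1 : min (δ / 2) 1 ≤ 1 := min_le_right _ _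
  have hm2 : min (δ / 2) 1 < δ := (min_le_left _ _).trans_lt (by linarith)
  constructor
  · obtain ⟨q, hq, hqz⟩ := hball (y := 1 - min (δ / 2) 1) (by
      rw [Real.dist_eq, sub_sub_cancel_left, abs_neg, abs_of_pos hmin]; exact hm2)
    refine ⟨q, hq, ?_⟩
    rw [hqz, M_smul, abs_of_nonneg (by linarith)]
    nlinarith
  · obtain ⟨q, hq, hqz⟩ := hball (y := 1 + min (δ / 2) 1) (by
      rw [Real.dist_eq, add_sub_cancel_left, abs_of_pos hmin]; exact hm2)
    refine ⟨q, hq, ?_⟩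
    rw [hqz, M_smul, abs_of_nonneg (by linarith)]
    nlinarith

/-! ### Area of the chord vectors and of the dividing points -/

/-- The positively oriented pairs of angles for which the length of the chord lies in `P`. -/
def anglePairs (P : Set ℝ) : Set ℂ :=
  {p | p.re ∈ Set.Ioc (-Real.pi) Real.pi ∧ p.re < p.im ∧ p.im < p.re + Real.pi ∧
    S.M (S.γ p.im - S.γ p.re) ∈ P}

theorem measurableSet_anglePairs {P : Set ℝ} (hP : MeasurableSet P) :
    MeasurableSet (S.anglePairs P) := by
  have h : Continuous fun p : ℂ => S.M (S.γ p.im - S.γ p.re) :=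
    S.continuous_M.comp ((S.continuous_γ.comp Complex.continuous_im).sub
      (S.continuous_γ.comp Complex.continuous_re))
  exact (Complex.measurable_re measurableSet_Ioc).inter
    ((measurableSet_lt Complex.measurable_re Complex.measurable_im).inter
      ((measurableSet_lt Complex.measurable_im (by fun_prop)).inter (h.measurable hP)))

theorem injOn_comb {t : ℝ} (ht0 : 0 < t) (ht1 : t < 1) (P : Set ℝ) :
    Set.InjOn (S.comb t (1 - t)) (S.anglePairs P) := by
  rintro p ⟨⟨hp1, hp2⟩, hp3, hp4, -⟩ q ⟨⟨hq1, hq2⟩, hq3, hq4, -⟩ h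
  obtain ⟨h1, h2⟩ := S.eq_of_convexCombination_eq ht0 ht1 (S.M_γ _) (S.M_γ _) (S.M_γ _) (S.M_γ _)
    (S.wedge_γ_pos hp3 hp4) (S.wedge_γ_pos hq3 hq4) h
  have hre : p.re = q.re := S.γ_injOn h1 (by rw [abs_lt]; constructor <;> linarith)
  refine Complex.ext hre (S.γ_injOn h2 ?_)
  have := Real.pi_pos
  rw [abs_lt]
  constructor <;> linarith

/-- The Jacobians differ only by the constant. Injectivity makes the area on the right equal to the
integral of its Jacobian; on the left the integral is an upper bound without injectivity. -/
theorem volume_image_comb {t : ℝ} (ht0 : 0 < t) (ht1 : t < 1) {P : Set ℝ}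
    (hP : MeasurableSet P) :
    ENNReal.ofReal (t * (1 - t)) * volume (S.comb (-1) 1 '' S.anglePairs P) ≤
      volume (S.comb t (1 - t) '' S.anglePairs P) := by
  have hm := S.measurableSet_anglePairs hP
  have htt : 0 ≤ t * (1 - t) := mul_nonneg ht0.le (by linarith)
  rw [← lintegral_abs_det_fderiv_eq_addHaar_image volume hm
    (fun p _ => (S.hasStrictFDerivAt_comb t (1 - t) p).hasFDerivAt.hasFDerivWithinAt)
    (S.injOn_comb ht0 ht1 P)]
  refine (mul_le_mul_right (addHaar_image_le_lintegral_abs_det_fderiv volume hm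
    (fun p _ => (S.hasStrictFDerivAt_comb (-1) 1 p).hasFDerivAt.hasFDerivWithinAt)) _).trans ?_
  rw [← lintegral_const_mul' _ _ ENNReal.ofReal_ne_top]
  refine lintegral_mono fun p => ?_
  rw [← ENNReal.ofReal_mul htt, det_combDeriv, det_combDeriv, abs_mul (t * (1 - t)),
    abs_of_nonneg htt]
  simp

theorem γ_sub_pi (θ : ℝ) : S.γ (θ - Real.pi) = -S.γ θ := by
  have he : Complex.exp ((θ - Real.pi : ℝ) * Complex.I) = -Complex.exp (θ * Complex.I) := by
    rw [Complex.ofReal_sub, sub_mul, Complex.exp_sub, Complex.exp_pi_mul_I, div_neg, div_one]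
  have hr : S.radial (θ - Real.pi) = S.radial θ := by
    rw [← S.M_exp, he, map_neg_eq_map, S.M_exp]
  rw [γ, γ, hr, he, smul_neg]

theorem M_smul_γ_arg (w : ℂ) : S.M w • S.γ w.arg = w := by
  rw [γ, smul_smul, S.M_eq, mul_inv_cancel_right₀ (S.radial_pos _).ne', Complex.real_smul,
    Complex.norm_mul_exp_arg_mul_I]

/-- As a unit vector `a` turns from the direction of `w` to the opposite one, the norm of `a + w`
goes from `1 + M w > 1` to `|M w - 1| < 1`. Where it equals 1, `w` is the chord from `a` to `a + w`.
-/
theorem mem_image_comb {P : Set ℝ} {w : ℂ} (h0 : 0 < S.M w) (h2 : S.M w < 2) (hP : S.M w ∈ P) :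
    w ∈ S.comb (-1) 1 '' S.anglePairs P := by
  have hcont : ContinuousOn (fun θ => S.M (S.γ (w.arg - θ) + w)) (Set.Icc 0 Real.pi) :=
    (S.continuous_M.comp ((S.continuous_γ.comp (by fun_prop)).add continuous_const)).continuousOn
  have hw := S.M_smul_γ_arg w
  have e0 : S.M (S.γ (w.arg - 0) + w) = 1 + S.M w := by
    have : S.γ (w.arg - 0) + w = (1 + S.M w) • S.γ w.arg := by
      rw [add_smul, one_smul, hw, sub_zero]
    rw [this, M_smul, M_γ, mul_one, abs_of_pos (by linarith)]
  have e1 : S.M (S.γ (w.arg - Real.pi) + w) = |S.M w - 1| := by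
    have : S.γ (w.arg - Real.pi) + w = (S.M w - 1) • S.γ w.arg := by
      rw [sub_smul, one_smul, hw, γ_sub_pi]; abel
    rw [this, M_smul, M_γ, mul_one]
  have hlt : |S.M w - 1| < 1 := by rw [abs_lt]; constructor <;> linarith
  obtain ⟨θ, hθ, hθ1⟩ := intermediate_value_Ioo' Real.pi_pos.le hcont
    (show (1 : ℝ) ∈ Set.Ioo _ _ by
      rw [e0, e1]
      exact ⟨hlt, by linarith⟩)
  have hwd : 0 < wedge (S.γ (w.arg - θ)) (S.γ (w.arg - θ) + w) := by
    have : wedge (S.γ (w.arg - θ)) (S.γ (w.arg - θ) + w) =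
        S.M w * wedge (S.γ (w.arg - θ)) (S.γ w.arg) := by
      have aux : ∀ (a u : ℂ) (c : ℝ), wedge a (a + c • u) = c * wedge a u := fun a u c => by
        simp only [wedge, Complex.add_re, Complex.add_im, Complex.smul_re, Complex.smul_im,
          smul_eq_mul]
        ring
      rw [← aux, hw]
    rw [this]
    exact mul_pos h0 (S.wedge_γ_pos (by linarith [hθ.1]) (by linarith [hθ.2]))
  obtain ⟨α, β, h1, h2, h3, h4, h5⟩ := S.exists_angles (S.M_γ _) hθ1 hwd
  have h6 : S.γ β - S.γ α = w := by rw [h5, h4]; abel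
  refine ⟨⟨α, β⟩, ⟨h1, h2, h3, ?_⟩, ?_⟩
  · rw [h6]; exact hP
  · rw [comb, one_smul, neg_one_smul, ← h6]; abel

theorem isCompact_closedBall (r : ℝ) : IsCompact {v | S.M v ≤ r} := by
  refine Metric.isCompact_of_isClosed_isBounded (isClosed_le S.continuous_M continuous_const) ?_
  obtain ⟨θ, -, hθ⟩ := isCompact_Icc.exists_isMinOn
    (Set.nonempty_Icc.2 (by linarith [Real.pi_pos] : -Real.pi ≤ Real.pi))
    S.continuous_radial.continuousOn
  refine (Metric.isBounded_closedBall (x := (0 : ℂ)) (r := r / S.radial θ)).subset fun v hv => ?_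
  have h1 : S.radial θ ≤ S.radial v.arg := hθ ⟨(Complex.neg_pi_lt_arg v).le, Complex.arg_le_pi v⟩
  have h2 : S.M v ≤ r := hv
  rw [S.M_eq] at h2
  rw [mem_closedBall_zero_iff, le_div_iff₀ (S.radial_pos θ)]
  exact (mul_le_mul_of_nonneg_left h1 (norm_nonneg v)).trans h2

/-- The area of the unit ball. -/
noncomputable def area : ℝ := (volume {v | S.M v ≤ 1}).toReal

theorem area_pos : 0 < S.area := by
  refine ENNReal.toReal_pos (ne_of_gt ?_) (S.isCompact_closedBall 1).measure_ne_top
  have hopen : IsOpen {v | S.M v < 1} := isOpen_lt S.continuous_M continuous_const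
  exact (hopen.measure_pos volume ⟨0, by simp⟩).trans_le
    (measure_mono fun v (hv : S.M v < 1) => hv.le)

theorem volume_closedBall {r : ℝ} (hr : 0 ≤ r) :
    volume {v | S.M v ≤ r} = ENNReal.ofReal (r ^ 2 * S.area) := by
  rcases hr.eq_or_lt with rfl | hr
  · have : {v | S.M v ≤ 0} = {0} := by
      ext v
      simp only [Set.mem_ofPred_eq, Set.mem_singleton_iff]
      refine ⟨fun h => ?_, fun h => by simp [h]⟩
      by_contra hv
      exact absurd (S.M_pos hv) (not_lt.2 h)
    rw [this]; simp
  · have h1 : {v | S.M v ≤ r} = r • {v | S.M v ≤ 1} := by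
      ext v
      rw [Set.mem_smul_set_iff_inv_smul_mem₀ hr.ne']
      simp only [Set.mem_ofPred_eq, M_smul, abs_of_pos (inv_pos.2 hr)]
      rw [inv_mul_le_iff₀ hr, mul_one]
    rw [h1, Measure.addHaar_smul, Complex.finrank_real_complex, abs_of_pos (pow_pos hr 2),
      ENNReal.ofReal_mul (sq_nonneg r), area,
      ENNReal.ofReal_toReal (S.isCompact_closedBall 1).measure_ne_top]

theorem le_volume_ball (r : ℝ) (hr : 0 ≤ r) :
    ENNReal.ofReal (r ^ 2 * S.area) ≤ volume {v | S.M v < r} := by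
  rcases hr.eq_or_lt with rfl | hr
  · simp
  · have hlim : Tendsto (fun q : ℝ => ENNReal.ofReal (q ^ 2 * S.area)) (𝓝[<] r)
        (𝓝 (ENNReal.ofReal (r ^ 2 * S.area))) :=
      ((ENNReal.continuous_ofReal.comp (by fun_prop)).tendsto r).mono_left nhdsWithin_le_nhds
    refine le_of_tendsto hlim ?_
    filter_upwards [Ioo_mem_nhdsLT hr] with q hq
    rw [← S.volume_closedBall hq.1.le]
    exact measure_mono fun v (hv : S.M v ≤ q) => hv.trans_lt hq.2

theorem volume_annulus_le {p r : ℝ} (hp : 0 ≤ p) (hr : 0 ≤ r) {A : Set ℂ}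
    (hA : ∀ v ∈ A, p ≤ S.M v ∧ S.M v ≤ r) :
    volume A ≤ ENNReal.ofReal ((r ^ 2 - p ^ 2) * S.area) := by
  rcases lt_or_ge r p with hrp | hrp
  · have : A = ∅ := Set.eq_empty_of_forall_notMem fun v hv => by linarith [(hA v hv).1, (hA v hv).2]
    rw [this]; simp
  have hopen : IsOpen {v | S.M v < p} := isOpen_lt S.continuous_M continuous_const
  have hsub : {v | S.M v < p} ⊆ {v | S.M v ≤ r} := fun v (hv : S.M v < p) => hv.le.trans hrp
  have h1 : A ⊆ {v | S.M v ≤ r} \ {v | S.M v < p} :=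
    fun v hv => ⟨(hA v hv).2, not_lt.2 (hA v hv).1⟩
  refine (measure_mono h1).trans ?_
  rw [measure_sdiff hsub hopen.measurableSet.nullMeasurableSet
    ((measure_mono hsub).trans_lt (S.isCompact_closedBall r).measure_lt_top).ne,
    S.volume_closedBall hr, sub_mul,
    ENNReal.ofReal_sub _ (mul_nonneg (sq_nonneg p) S.area_pos.le)]
  exact tsub_le_tsub_left (S.le_volume_ball p hp) _

theorem le_volume_annulus {p r : ℝ} (hp : 0 ≤ p) (hr : 0 ≤ r) {A : Set ℂ}
    (hA : ∀ v, p < S.M v → S.M v < r → v ∈ A) :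
    ENNReal.ofReal ((r ^ 2 - p ^ 2) * S.area) ≤ volume A := by
  rw [sub_mul, ENNReal.ofReal_sub _ (mul_nonneg (sq_nonneg p) S.area_pos.le),
    ← S.volume_closedBall hp]
  refine (tsub_le_tsub_right (S.le_volume_ball r hr) _).trans (le_measure_sdiff.trans ?_)
  exact measure_mono fun v hv => hA v (not_le.1 hv.2) hv.1

/-- Area comparison: if the chords with length in `P ⊇ (p, r)` have their dividing points in the
annulus with radii `p'` and `r'`, then this annulus is at least `t (1 - t)` times as large as the
one with radii `p` and `r`. -/
theorem area_comparison {t : ℝ} (ht0 : 0 < t) (ht1 : t < 1) {P : Set ℝ} (hP : MeasurableSet P)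
    {p r p' r' : ℝ} (hp : 0 ≤ p) (hr : p < r) (hr2 : r ≤ 2) (hsub : Set.Ioo p r ⊆ P)
    (hp' : 0 ≤ p') (hr' : 0 ≤ r')
    (h : ∀ x y : ℂ, S.M x = 1 → S.M y = 1 → 0 ≤ wedge x y → S.M (y - x) ∈ P →
      p' ≤ S.M (t • x + (1 - t) • y) ∧ S.M (t • x + (1 - t) • y) ≤ r') :
    t * (1 - t) * (r ^ 2 - p ^ 2) ≤ r' ^ 2 - p' ^ 2 := by
  have h1 : ENNReal.ofReal ((r ^ 2 - p ^ 2) * S.area) ≤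
      volume (S.comb (-1) 1 '' S.anglePairs P) :=
    S.le_volume_annulus hp (hp.trans hr.le) fun v hv1 hv2 =>
      S.mem_image_comb (hp.trans_lt hv1) (hv2.trans_le hr2) (hsub ⟨hv1, hv2⟩)
  have h2 : volume (S.comb t (1 - t) '' S.anglePairs P) ≤
      ENNReal.ofReal ((r' ^ 2 - p' ^ 2) * S.area) := by
    refine S.volume_annulus_le hp' hr' ?_
    rintro _ ⟨q, ⟨-, hq1, hq2, hq3⟩, rfl⟩
    exact h _ _ (S.M_γ _) (S.M_γ _) (S.wedge_γ_pos hq1 hq2).le hq3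
  have h3 := (mul_le_mul_right h1 (ENNReal.ofReal (t * (1 - t)))).trans
    ((S.volume_image_comb ht0 ht1 hP).trans h2)
  have htt : 0 < t * (1 - t) := mul_pos ht0 (by linarith)
  have hpos : 0 < t * (1 - t) * ((r ^ 2 - p ^ 2) * S.area) :=
    mul_pos htt (mul_pos (by nlinarith) S.area_pos)
  rw [← ENNReal.ofReal_mul htt.le, ENNReal.ofReal_le_ofReal_iff'] at h3
  rcases h3 with h3 | h3
  -- `ENNReal.ofReal` truncates at 0; the other alternative, a nonpositive left side, contradicts
  -- `hpos`.
  · rw [← mul_assoc] at h3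
    exact le_of_mul_le_mul_right h3 S.area_pos
  · linarith

theorem eq_or_eq_neg_of_wedge_eq_zero {x y : ℂ} (hx : S.M x = 1) (hy : S.M y = 1)
    (h : wedge x y = 0) : y = x ∨ y = -x := by
  have hx0 : x ≠ 0 := by rintro rfl; simp at hx
  obtain ⟨c, rfl⟩ := exists_smul_of_wedge_eq_zero hx0 h
  rw [M_smul, hx, mul_one] at hy
  rcases eq_or_eq_neg_of_abs_eq hy with rfl | rfl
  · left; simp
  · right; simp

/-! ### Extremal chords of regular norms -/

/-- The oriented pairs of unit vectors whose distance lies in `P`. -/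
def unitPairs (P : Set ℝ) : Set (ℂ × ℂ) :=
  {q | S.M q.1 = 1 ∧ S.M q.2 = 1 ∧ 0 ≤ wedge q.1 q.2 ∧ S.M (q.2 - q.1) ∈ P}

theorem isCompact_unitPairs {P : Set ℝ} (hP : IsClosed P) : IsCompact (S.unitPairs P) := by
  refine ((S.isCompact_closedBall 1).prod (S.isCompact_closedBall 1)).of_isClosed_subset ?_
    fun q hq => ⟨hq.1.le, hq.2.1.le⟩
  have hM := S.continuous_M
  have hw : Continuous fun q : ℂ × ℂ => wedge q.1 q.2 := by
    unfold wedge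
    fun_prop
  exact (isClosed_eq (hM.comp continuous_fst) continuous_const).inter
    ((isClosed_eq (hM.comp continuous_snd) continuous_const).inter
      ((isClosed_le continuous_const hw).inter
        (hP.preimage (hM.comp (continuous_snd.sub continuous_fst)))))

theorem continuous_M_comb (t : ℝ) :
    Continuous fun q : ℂ × ℂ => S.M (t • q.1 + (1 - t) • q.2) :=
  S.continuous_M.comp (by fun_prop)

/-- A pair in general position is not a local extremum of the norm of the dividing point. -/
theorem exists_lt_and_exists_gt {t : ℝ} (ht0 : 0 < t) (ht1 : t < 1) {P : Set ℝ} {q : ℂ × ℂ}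
    (hq : q ∈ S.unitPairs P) (hw : 0 < wedge q.1 q.2) (hP : P ∈ 𝓝 (S.M (q.2 - q.1))) :
    (∃ q' ∈ S.unitPairs P, S.M (t • q'.1 + (1 - t) • q'.2) < S.M (t • q.1 + (1 - t) • q.2)) ∧
      ∃ q' ∈ S.unitPairs P,
        S.M (t • q.1 + (1 - t) • q.2) < S.M (t • q'.1 + (1 - t) • q'.2) := by
  obtain ⟨x, y⟩ := q
  obtain ⟨α, β, -, -, -, rfl, rfl⟩ := S.exists_angles hq.1 hq.2.1 hw
  have hγr : Continuous fun p : ℂ => S.γ p.re := S.continuous_γ.comp Complex.continuous_re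
  have hγi : Continuous fun p : ℂ => S.γ p.im := S.continuous_γ.comp Complex.continuous_im
  have hU : {p : ℂ | (S.γ p.re, S.γ p.im) ∈ S.unitPairs P} ∈ 𝓝 (⟨α, β⟩ : ℂ) := by
    have c1 : Continuous fun p : ℂ => S.M (S.γ p.im - S.γ p.re) :=
      S.continuous_M.comp (hγi.sub hγr)
    have c2 : Continuous fun p : ℂ => wedge (S.γ p.re) (S.γ p.im) := by
      exact ((Complex.continuous_re.comp hγr).mul (Complex.continuous_im.comp hγi)).sub
        ((Complex.continuous_im.comp hγr).mul (Complex.continuous_re.comp hγi))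
    filter_upwards [c1.continuousAt.preimage_mem_nhds (t := P) hP,
      c2.continuousAt.preimage_mem_nhds (t := Set.Ioi 0) (Ioi_mem_nhds hw)] with p hp1 hp2
    exact ⟨S.M_γ _, S.M_γ _, le_of_lt hp2, hp1⟩
  obtain ⟨⟨p, hp, h1⟩, p', hp', h2⟩ :=
    S.exists_comb_lt_and_exists_comb_gt ht0.ne' (sub_pos.2 ht1).ne' (p := ⟨α, β⟩) hw hU
  exact ⟨⟨_, hp, h1⟩, _, hp', h2⟩

theorem exists_M_eq_one : ∃ x, S.M x = 1 := ⟨S.γ 0, S.M_γ 0⟩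

theorem wedge_self (x : ℂ) : wedge x x = 0 := by unfold wedge; ring

theorem wedge_neg_self (x : ℂ) : wedge x (-x) = 0 := by simp [wedge]; ring

theorem exists_pair_le {t ε : ℝ} (ht0 : 0 < t) (ht1 : t < 1) (hε0 : 0 < ε) (hε2 : ε < 2) :
    ∃ x y, S.M x = 1 ∧ S.M y = 1 ∧ S.M (y - x) = ε ∧
      S.M (t • x + (1 - t) • y) ≤ Real.sqrt (1 - t * (1 - t) * ε ^ 2) := by
  by_contra! hcon
  set r := Real.sqrt (1 - t * (1 - t) * ε ^ 2) with hr
  have hpos : 0 < t * (1 - t) * ε ^ 2 := by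
    have : 0 < 1 - t := by linarith
    positivity
  have hr1 : r < 1 := by rw [hr, Real.sqrt_lt' one_pos]; linarith
  obtain ⟨u, hu⟩ := S.exists_M_eq_one
  obtain ⟨q, hq, hmin⟩ := (S.isCompact_unitPairs (isClosed_Iic (a := ε))).exists_isMinOn
    ⟨(u, u), hu, hu, (wedge_self u).ge, by simp [hε0.le]⟩ (S.continuous_M_comb t).continuousOn
  -- A minimizer has length `ε`, or is degenerate with `y = x` and value 1; `y = -x` would have
  -- length 2, and any other pair is not a local minimum.
  have hlt : r < S.M (t • q.1 + (1 - t) • q.2) := by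
    have hle : S.M (q.2 - q.1) ≤ ε := hq.2.2.2
    rcases hle.eq_or_lt with he | he
    · exact hcon _ _ hq.1 hq.2.1 he
    rcases hq.2.2.1.eq_or_lt with hw | hw
    · rcases S.eq_or_eq_neg_of_wedge_eq_zero hq.1 hq.2.1 hw.symm with h | h
      · rw [h, ← add_smul, add_sub_cancel, one_smul, hq.1]; exact hr1
      · rw [h] at he
        have : -q.1 - q.1 = (-2 : ℝ) • q.1 := by module
        rw [this, M_smul, hq.1] at he
        norm_num at he
        linarith
    · obtain ⟨⟨q', hq', hlt⟩, -⟩ := S.exists_lt_and_exists_gt ht0 ht1 hq hw (Iic_mem_nhds he)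
      exact absurd (isMinOn_iff.1 hmin q' hq') (not_le.2 hlt)
  have hcomp := S.area_comparison ht0 ht1 (measurableSet_Iic (a := ε)) le_rfl hε0 hε2.le
    (fun s hs => hs.2.le) (apply_nonneg S.M (t • q.1 + (1 - t) • q.2)) zero_le_one
    fun x y hx hy hw hP => by
      refine ⟨isMinOn_iff.1 hmin (x, y) ⟨hx, hy, hw, hP⟩, ?_⟩
      refine (map_add_le_add S.M _ _).trans ?_
      rw [M_smul, M_smul, hx, hy, abs_of_pos ht0, abs_of_pos (sub_pos.2 ht1)]
      linarith
  have h1 : Real.sqrt (1 - t * (1 - t) * ε ^ 2) < S.M (t • q.1 + (1 - t) • q.2) := hlt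
  rw [Real.sqrt_lt' ((Real.sqrt_nonneg _).trans_lt h1)] at h1
  linarith

theorem exists_pair_ge {t ε : ℝ} (ht0 : 0 < t) (ht1 : t < 1) (hε0 : 0 < ε) (hε2 : ε < 2) :
    ∃ x y, S.M x = 1 ∧ S.M y = 1 ∧ S.M (y - x) = ε ∧
      Real.sqrt (1 - t * (1 - t) * ε ^ 2) ≤ S.M (t • x + (1 - t) • y) := by
  by_contra! hcon
  set r := Real.sqrt (1 - t * (1 - t) * ε ^ 2) with hr
  have hpos : 0 < t * (1 - t) := mul_pos ht0 (by linarith)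
  -- `|2 t - 1|` is the norm of the dividing point of an antipodal pair; its square is `1 - 4 t (1 -
  -- t)`.
  have hr1 : |2 * t - 1| < r := by
    rw [hr]
    apply Real.lt_sqrt_of_sq_lt
    rw [sq_abs]
    have := mul_lt_mul_of_pos_left (show ε ^ 2 < 4 by nlinarith) hpos
    linarith
  obtain ⟨u, hu⟩ := S.exists_M_eq_one
  obtain ⟨q, hq, hmax⟩ := (S.isCompact_unitPairs (isClosed_Ici (a := ε))).exists_isMaxOn
    ⟨(u, -u), hu, by rw [map_neg_eq_map, hu], (wedge_neg_self u).ge, by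
      have : -u - u = (-2 : ℝ) • u := by module
      simp only [Set.mem_Ici]
      rw [this, M_smul, hu]
      norm_num
      exact hε2.le⟩ (S.continuous_M_comb t).continuousOn
  have hlt : S.M (t • q.1 + (1 - t) • q.2) < r := by
    have hle : ε ≤ S.M (q.2 - q.1) := hq.2.2.2
    rcases hle.eq_or_lt with he | he
    · exact hcon _ _ hq.1 hq.2.1 he.symm
    rcases hq.2.2.1.eq_or_lt with hw | hw
    · rcases S.eq_or_eq_neg_of_wedge_eq_zero hq.1 hq.2.1 hw.symm with h | h
      · rw [h, sub_self, map_zero] at he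
        linarith
      · have : t • q.1 + (1 - t) • (-q.1) = (2 * t - 1) • q.1 := by module
        rw [h, this, M_smul, hq.1, mul_one]
        exact hr1
    · obtain ⟨-, q', hq', hlt⟩ := S.exists_lt_and_exists_gt ht0 ht1 hq hw (Ici_mem_nhds he)
      exact absurd (isMaxOn_iff.1 hmax q' hq') (not_le.2 hlt)
  -- The annulus from `ε` to 2 gives `t (1 - t) (4 - ε²) ≤ m² - (2 t - 1)²` for the maximum `m`,
  -- that is `1 - t (1 - t) ε² ≤ m²`.
  have hcomp := S.area_comparison ht0 ht1 (measurableSet_Ici (a := ε)) hε0.le hε2 le_rfl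
    (fun s hs => hs.1.le) (abs_nonneg (2 * t - 1))
    (apply_nonneg S.M (t • q.1 + (1 - t) • q.2))
    fun x y hx hy hw hP => by
      refine ⟨?_, isMaxOn_iff.1 hmax (x, y) ⟨hx, hy, hw, hP⟩⟩
      have h1 := map_sub_le_add S.M (t • x + (1 - t) • y) ((1 - t) • y)
      have h2 := map_sub_le_add S.M (t • x + (1 - t) • y) (t • x)
      rw [add_sub_cancel_right, M_smul, M_smul, hx, hy, abs_of_pos ht0,
        abs_of_pos (sub_pos.2 ht1)] at h1
      rw [add_sub_cancel_left, M_smul, M_smul, hx, hy, abs_of_pos ht0,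
        abs_of_pos (sub_pos.2 ht1)] at h2
      rw [abs_le]
      constructor <;> linarith
  have h1 : S.M (t • q.1 + (1 - t) • q.2) < Real.sqrt (1 - t * (1 - t) * ε ^ 2) := hlt
  rw [Real.lt_sqrt (apply_nonneg S.M _)] at h1
  rw [sq_abs] at hcomp
  nlinarith

end RegularPlaneNorm

/-! ### Approximation of planar norms by regular ones -/

theorem Seminorm.exists_le_mul_norm (N : Seminorm ℝ ℂ) : ∃ K, 0 ≤ K ∧ ∀ v, N v ≤ K * ‖v‖ := by
  refine ⟨N 1 + N Complex.I, add_nonneg (apply_nonneg N _) (apply_nonneg N _), fun v => ?_⟩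
  have hv : v = v.re • (1 : ℂ) + v.im • Complex.I := by simp [Complex.re_add_im]
  have h : N v ≤ |v.re| * N 1 + |v.im| * N Complex.I := by
    conv_lhs => rw [hv]
    refine (map_add_le_add N _ _).trans_eq ?_
    rw [map_smul_eq_mul, map_smul_eq_mul, Real.norm_eq_abs, Real.norm_eq_abs]
  have h1 := mul_le_mul_of_nonneg_right (Complex.abs_re_le_norm v) (apply_nonneg N 1)
  have h2 := mul_le_mul_of_nonneg_right (Complex.abs_im_le_norm v) (apply_nonneg N Complex.I)
  linarith

theorem Seminorm.continuous_of_complex (N : Seminorm ℝ ℂ) : Continuous N :=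
  N.convexOn.locallyLipschitz.continuous

theorem Seminorm.exists_mul_norm_le (N : Seminorm ℝ ℂ) (hN : ∀ v, v ≠ 0 → 0 < N v) :
    ∃ c, 0 < c ∧ ∀ v, c * ‖v‖ ≤ N v := by
  obtain ⟨u, hu, hmin⟩ := (isCompact_sphere (0 : ℂ) 1).exists_isMinOn
    ⟨1, by simp⟩ N.continuous_of_complex.continuousOn
  have hu0 : u ≠ 0 := by rintro rfl; simp at hu
  refine ⟨N u, hN u hu0, fun v => ?_⟩
  rcases eq_or_ne v 0 with rfl | hv
  · simp
  have hv' : 0 < ‖v‖ := norm_pos_iff.2 hv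
  have h := isMinOn_iff.1 hmin (‖v‖⁻¹ • v) (by simp [hv'.ne'])
  rw [map_smul_eq_mul, norm_inv, norm_norm, inv_mul_eq_div, le_div_iff₀ hv'] at h
  exact h

section smoothing

variable (N : Seminorm ℝ ℂ)

theorem Seminorm.continuous_rotation (v : ℂ) :
    Continuous fun s : ℝ => N (Complex.exp (s * Complex.I) * v) :=
  N.continuous_of_complex.comp (by fun_prop)

/-- The mean of `N` over the rotations by angles in `[0, η]`, plus `η` times the Euclidean norm. -/
noncomputable def Seminorm.smoothing (η : ℝ) (hη : 0 < η) : Seminorm ℝ ℂ :=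
  Seminorm.of (fun v => η⁻¹ * (∫ s in (0 : ℝ)..η, N (Complex.exp (s * Complex.I) * v)) + η * ‖v‖)
    (fun x y => by
      have h1 : (∫ s in (0 : ℝ)..η, N (Complex.exp (s * Complex.I) * (x + y))) ≤
          (∫ s in (0 : ℝ)..η, N (Complex.exp (s * Complex.I) * x)) +
            ∫ s in (0 : ℝ)..η, N (Complex.exp (s * Complex.I) * y) := by
        rw [← intervalIntegral.integral_add ((N.continuous_rotation x).intervalIntegrable _ _)
          ((N.continuous_rotation y).intervalIntegrable _ _)]
        refine intervalIntegral.integral_mono_on hη.le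
          ((N.continuous_rotation _).intervalIntegrable _ _)
          (((N.continuous_rotation x).add (N.continuous_rotation y)).intervalIntegrable _ _)
          fun s _ => ?_
        rw [mul_add]
        exact map_add_le_add N _ _
      have h2 := mul_le_mul_of_nonneg_left h1 (inv_pos.2 hη).le
      have h3 := mul_le_mul_of_nonneg_left (norm_add_le x y) hη.le
      linarith)
    (fun a x => by
      have h1 : ∀ s : ℝ, N (Complex.exp (s * Complex.I) * a • x) =
          ‖a‖ * N (Complex.exp (s * Complex.I) * x) := fun s => by
        rw [mul_smul_comm, map_smul_eq_mul]
      simp only [h1, intervalIntegral.integral_const_mul, norm_smul]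
      ring)

theorem Seminorm.smoothing_apply {η : ℝ} (hη : 0 < η) (v : ℂ) :
    N.smoothing η hη v =
      η⁻¹ * (∫ s in (0 : ℝ)..η, N (Complex.exp (s * Complex.I) * v)) + η * ‖v‖ := rfl

/-- The Euclidean summand makes the triangle inequality strict off common rays; on a common ray,
norm 1 determines the vector. -/
theorem Seminorm.smoothing_strict {η : ℝ} (hη : 0 < η) {x y : ℂ}
    (hx : N.smoothing η hη x ≤ 1) (hy : N.smoothing η hη y ≤ 1) (hxy : x ≠ y) {a b : ℝ}
    (ha : 0 < a) (hb : 0 < b) (hab : a + b = 1) : N.smoothing η hη (a • x + b • y) < 1 := by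
  set M := N.smoothing η hη with hM
  have hpos : ∀ v, v ≠ 0 → 0 < M v := fun v hv => by
    rw [hM, smoothing_apply]
    have h1 : 0 ≤ ∫ s in (0 : ℝ)..η, N (Complex.exp (s * Complex.I) * v) :=
      intervalIntegral.integral_nonneg hη.le fun s _ => apply_nonneg N _
    have h2 : 0 < ‖v‖ := norm_pos_iff.2 hv
    positivity
  have hax : M (a • x) = a * M x := by rw [map_smul_eq_mul, Real.norm_eq_abs, abs_of_pos ha]
  have hby : M (b • y) = b * M y := by rw [map_smul_eq_mul, Real.norm_eq_abs, abs_of_pos hb]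
  by_cases hray : SameRay ℝ (a • x) (b • y)
  · refine lt_of_le_of_ne ?_ fun h => hxy ?_
    · refine (map_add_le_add M _ _).trans ?_
      rw [hax, hby]
      nlinarith
    have hle := map_add_le_add M (a • x) (b • y)
    rw [h, hax, hby] at hle
    have hx1 : M x = 1 := by nlinarith
    have hy1 : M y = 1 := by nlinarith
    have hray' : SameRay ℝ x y := by
      have := (SameRay.sameRay_pos_smul_left x (R := ℝ) ha).symm.trans
        (hray.trans (SameRay.sameRay_pos_smul_left y (R := ℝ) hb) ?_) ?_
      · exact this
      · intro h0
        rw [h0, map_zero] at hby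
        nlinarith
      · intro h0
        rw [h0, map_zero] at hax
        nlinarith
    obtain ⟨u, p, q, hp, hq, -, rfl, rfl⟩ := hray'.exists_eq_smul
    rw [map_smul_eq_mul, Real.norm_eq_abs, abs_of_nonneg hp] at hx1
    rw [map_smul_eq_mul, Real.norm_eq_abs, abs_of_nonneg hq] at hy1
    have hu : M u ≠ 0 := by rintro h0; rw [h0] at hx1; simp at hx1
    have : p = q := mul_right_cancel₀ hu (hx1.trans hy1.symm)
    rw [this]
  · have hlt : ‖a • x + b • y‖ < ‖a • x‖ + ‖b • y‖ := norm_add_lt_of_not_sameRay hray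
    have h1 : M (a • x + b • y) < M (a • x) + M (b • y) := by
      have h2 : (∫ s in (0 : ℝ)..η, N (Complex.exp (s * Complex.I) * (a • x + b • y))) ≤
          (∫ s in (0 : ℝ)..η, N (Complex.exp (s * Complex.I) * (a • x))) +
            ∫ s in (0 : ℝ)..η, N (Complex.exp (s * Complex.I) * (b • y)) := by
        rw [← intervalIntegral.integral_add ((N.continuous_rotation _).intervalIntegrable _ _)
          ((N.continuous_rotation _).intervalIntegrable _ _)]
        refine intervalIntegral.integral_mono_on hη.le
          ((N.continuous_rotation _).intervalIntegrable _ _)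
          (((N.continuous_rotation _).add (N.continuous_rotation _)).intervalIntegrable _ _)
          fun s _ => ?_
        rw [mul_add]
        exact map_add_le_add N _ _
      have h3 := mul_le_mul_of_nonneg_left h2 (inv_pos.2 hη).le
      have h4 := mul_lt_mul_of_pos_left hlt hη
      rw [hM, smoothing_apply, smoothing_apply, smoothing_apply]
      linarith
    rw [hax, hby] at h1
    nlinarith

/-- On the circle the mean becomes an integral over a moving window, so it is C¹ in the angle
although `N` is only continuous. -/
theorem Seminorm.smoothing_exp {η : ℝ} (hη : 0 < η) (θ : ℝ) :
    N.smoothing η hη (Complex.exp (θ * Complex.I)) =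
      η⁻¹ * (∫ s in θ..θ + η, N (Complex.exp (s * Complex.I))) + η := by
  rw [smoothing_apply, Complex.norm_exp_ofReal_mul_I, mul_one]
  have h : ∀ s : ℝ, N (Complex.exp (s * Complex.I) * Complex.exp (θ * Complex.I)) =
      (fun s : ℝ => N (Complex.exp (s * Complex.I))) (s + θ) := fun s => by
    dsimp only
    rw [← Complex.exp_add]
    congr 2
    push_cast
    ring
  simp only [h]
  rw [intervalIntegral.integral_comp_add_right (fun s : ℝ => N (Complex.exp (s * Complex.I))) θ,
    zero_add, add_comm η θ]

/-- The smoothing of a seminorm as a regular norm. -/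
noncomputable def Seminorm.regular (η : ℝ) (hη : 0 < η) : RegularPlaneNorm where
  M := N.smoothing η hη
  radial θ := η⁻¹ * (∫ s in θ..θ + η, N (Complex.exp (s * Complex.I))) + η
  radial' θ := η⁻¹ *
    (N (Complex.exp ((θ + η : ℝ) * Complex.I)) - N (Complex.exp (θ * Complex.I)))
  hasDerivAt_radial θ := by
    have hc : Continuous fun s : ℝ => N (Complex.exp (s * Complex.I)) :=
      N.continuous_of_complex.comp (by fun_prop)
    have hF : ∀ θ : ℝ, HasDerivAt (fun u => ∫ s in (0 : ℝ)..u, N (Complex.exp (s * Complex.I)))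
        (N (Complex.exp (θ * Complex.I))) θ := fun θ =>
      intervalIntegral.integral_hasDerivAt_right (hc.intervalIntegrable _ _)
        (hc.stronglyMeasurableAtFilter _ _) hc.continuousAt
    have h := ((hF (θ + η)).comp_add_const θ η).sub (hF θ)
    refine ((h.const_mul η⁻¹).add_const η).congr_of_eventuallyEq (Eventually.of_forall fun u => ?_)
    dsimp only
    rw [← intervalIntegral.integral_interval_sub_left (hc.intervalIntegrable 0 (u + η))
      (hc.intervalIntegrable 0 u)]
    rfl
  continuous_radial' := by
    have hc : Continuous fun s : ℝ => N (Complex.exp (s * Complex.I)) :=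
      N.continuous_of_complex.comp (by fun_prop)
    exact continuous_const.mul ((hc.comp (continuous_id.add continuous_const)).sub hc)
  radial_pos θ := by
    have h1 : 0 ≤ ∫ s in θ..θ + η, N (Complex.exp (s * Complex.I)) :=
      intervalIntegral.integral_nonneg (by linarith) fun s _ => apply_nonneg N _
    positivity
  M_exp θ := N.smoothing_exp hη θ
  strict _ _ hx hy hxy _ _ ha hb hab := N.smoothing_strict hη hx hy hxy ha hb hab

/-- A rotation by at most `η` moves `v` by at most `η ‖v‖`, which changes `N` by at most `K η ‖v‖`;
the Euclidean summand adds `η ‖v‖`. -/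
theorem Seminorm.abs_smoothing_sub_le {η K : ℝ} (hη : 0 < η) (hK0 : 0 ≤ K)
    (hK : ∀ v, N v ≤ K * ‖v‖) (v : ℂ) :
    |N.smoothing η hη v - N v| ≤ (K + 1) * η * ‖v‖ := by
  have h1 : ∀ s ∈ Set.uIoc (0 : ℝ) η,
      ‖N (Complex.exp (s * Complex.I) * v) - N v‖ ≤ K * η * ‖v‖ := by
    intro s hs
    rw [Set.uIoc_of_le hη.le] at hs
    rw [Real.norm_eq_abs]
    refine (abs_sub_map_le_sub N _ _).trans ((hK _).trans ?_)
    rw [← sub_one_mul, norm_mul, mul_assoc]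
    refine mul_le_mul_of_nonneg_left (mul_le_mul_of_nonneg_right ?_ (norm_nonneg v)) hK0
    rw [mul_comm]
    refine (Real.norm_exp_I_mul_ofReal_sub_one_le).trans ?_
    rw [Real.norm_eq_abs, abs_of_pos hs.1]
    exact hs.2
  have h2 := intervalIntegral.norm_integral_le_of_norm_le_const h1
  rw [intervalIntegral.integral_sub ((N.continuous_rotation v).intervalIntegrable _ _)
    intervalIntegrable_const, intervalIntegral.integral_const, sub_zero, smul_eq_mul,
    abs_of_pos hη, Real.norm_eq_abs] at h2
  have h3 : N.smoothing η hη v - N v =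
      η⁻¹ * ((∫ s in (0 : ℝ)..η, N (Complex.exp (s * Complex.I) * v)) - η * N v) + η * ‖v‖ := by
    rw [smoothing_apply, mul_sub, inv_mul_cancel_left₀ hη.ne']
    abel
  rw [h3]
  refine (abs_add_le _ _).trans ?_
  rw [abs_mul, abs_of_pos (inv_pos.2 hη), abs_of_nonneg (mul_nonneg hη.le (norm_nonneg v))]
  have h4 := mul_le_mul_of_nonneg_left h2 (inv_pos.2 hη).le
  have h5 : η⁻¹ * (K * η * ‖v‖ * η) = K * η * ‖v‖ := by field_simp
  linarith

theorem Seminorm.tendsto_smoothing {η : ℕ → ℝ} (hη : ∀ n, 0 < η n) (hlim : Tendsto η atTop (𝓝 0))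
    {v : ℕ → ℂ} {w : ℂ} (hv : Tendsto v atTop (𝓝 w)) :
    Tendsto (fun n => N.smoothing (η n) (hη n) (v n)) atTop (𝓝 (N w)) := by
  obtain ⟨K, hK0, hK⟩ := N.exists_le_mul_norm
  have h1 : Tendsto (fun n => (K + 1) * η n * ‖v n‖) atTop (𝓝 0) := by
    simpa using (hlim.const_mul (K + 1)).mul hv.norm
  have h2 : Tendsto (fun n => N.smoothing (η n) (hη n) (v n) - N (v n)) atTop (𝓝 0) :=
    squeeze_zero_norm (fun n => N.abs_smoothing_sub_le (hη n) hK0 hK (v n)) h1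
  simpa using h2.add ((N.continuous_of_complex.tendsto w).comp hv)

end smoothing

/-- What holds for the chords of all regular norms holds for the chords of all norms. -/
theorem Seminorm.exists_pair_of_regular (N : Seminorm ℝ ℂ) (hN : ∀ v, v ≠ 0 → 0 < N v)
    {ε t : ℝ} {C : Set ℝ} (hC : IsClosed C)
    (h : ∀ S : RegularPlaneNorm, ∃ x y, S.M x = 1 ∧ S.M y = 1 ∧ S.M (y - x) = ε ∧
      S.M (t • x + (1 - t) • y) ∈ C) :
    ∃ x y, N x = 1 ∧ N y = 1 ∧ N (y - x) = ε ∧ N (t • x + (1 - t) • y) ∈ C := by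
  obtain ⟨K, hK0, hK⟩ := N.exists_le_mul_norm
  obtain ⟨c, hc0, hc⟩ := N.exists_mul_norm_le hN
  -- For `η ≤ δ` the smoothing is at least `(c / 2) ‖v‖`, so all its unit vectors lie in one
  -- Euclidean ball of radius `2 / c`.
  set δ : ℝ := c / (2 * (K + 1)) with hδ
  have hδ0 : 0 < δ := by positivity
  set η : ℕ → ℝ := fun n => δ * (1 / ((n : ℝ) + 1)) with hηdef
  have hη : ∀ n, 0 < η n := fun n => by positivity
  have hlim : Tendsto η atTop (𝓝 0) := by
    rw [← mul_zero δ]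
    exact (tendsto_one_div_add_atTop_nhds_zero_nat (𝕜 := ℝ)).const_mul δ
  choose x y hx hy hxy hz using fun n => h (N.regular (η n) (hη n))
  have hb : ∀ n v, N.smoothing (η n) (hη n) v = 1 → ‖v‖ ≤ 2 / c := by
    intro n v hv
    have h1 := (abs_le.1 (N.abs_smoothing_sub_le (hη n) hK0 hK v)).1
    have h2 : η n ≤ δ := by
      refine mul_le_of_le_one_right hδ0.le ?_
      rw [div_le_one (by positivity)]
      linarith [Nat.cast_nonneg (α := ℝ) n]
    have h3 : (K + 1) * η n ≤ c / 2 := by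
      refine (mul_le_mul_of_nonneg_left h2 (by linarith)).trans_eq ?_
      rw [hδ]; field_simp
    have h4 := mul_le_mul_of_nonneg_right h3 (norm_nonneg v)
    have h5 := hc v
    rw [le_div_iff₀ hc0]
    linarith
  obtain ⟨⟨u, w⟩, -, φ, hφ, hlim2⟩ :=
    ((isCompact_closedBall (0 : ℂ) (2 / c)).prod (isCompact_closedBall (0 : ℂ) (2 / c))).tendsto_subseq
      (x := fun n => (x n, y n)) fun n =>
        ⟨mem_closedBall_zero_iff.2 (hb n _ (hx n)), mem_closedBall_zero_iff.2 (hb n _ (hy n))⟩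
  have hu : Tendsto (fun n => x (φ n)) atTop (𝓝 u) := (continuous_fst.tendsto _).comp hlim2
  have hw : Tendsto (fun n => y (φ n)) atTop (𝓝 w) := (continuous_snd.tendsto _).comp hlim2
  have key : ∀ {v : ℕ → ℂ} {v₀ : ℂ}, Tendsto v atTop (𝓝 v₀) →
      Tendsto (fun n => N.smoothing (η (φ n)) (hη (φ n)) (v n)) atTop (𝓝 (N v₀)) := fun hv =>
    N.tendsto_smoothing (fun n => hη (φ n)) (hlim.comp hφ.tendsto_atTop) hv
  refine ⟨u, w, ?_, ?_, ?_, ?_⟩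
  · exact tendsto_nhds_unique (key hu) (tendsto_const_nhds.congr fun n => (hx (φ n)).symm)
  · exact tendsto_nhds_unique (key hw) (tendsto_const_nhds.congr fun n => (hy (φ n)).symm)
  · exact tendsto_nhds_unique (key (hw.sub hu))
      (tendsto_const_nhds.congr fun n => (hxy (φ n)).symm)
  · exact hC.mem_of_tendsto (key ((hu.const_smul t).add (hw.const_smul (1 - t))))
      (Eventually.of_forall fun n => hz (φ n))

/-! ### Reduction to a plane, and the boundary values of the parameters -/

section NormedSpace

variable {X : Type*} [NormedAddCommGroup X] [NormedSpace ℝ X]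

/-- The norm that the plane spanned by `a` and `b` induces on `ℂ`. -/
noncomputable def planeSeminorm (a b : X) : Seminorm ℝ ℂ :=
  Seminorm.of (fun z => ‖z.re • a + z.im • b‖)
    (fun x y => by
      have : (x + y).re • a + (x + y).im • b =
          (x.re • a + x.im • b) + (y.re • a + y.im • b) := by
        rw [Complex.add_re, Complex.add_im]; module
      rw [this]
      exact norm_add_le _ _)
    (fun c x => by
      have : (c • x).re • a + (c • x).im • b = c • (x.re • a + x.im • b) := by
        rw [Complex.smul_re, Complex.smul_im, smul_eq_mul, smul_eq_mul]; module
      rw [this, norm_smul])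

theorem planeSeminorm_apply (a b : X) (z : ℂ) :
    planeSeminorm a b z = ‖z.re • a + z.im • b‖ := rfl

theorem exists_chord_of_regular (hX : 2 ≤ Module.rank ℝ X) {ε t : ℝ} {C : Set ℝ}
    (hC : IsClosed C)
    (h : ∀ S : RegularPlaneNorm, ∃ x y, S.M x = 1 ∧ S.M y = 1 ∧ S.M (y - x) = ε ∧
      S.M (t • x + (1 - t) • y) ∈ C) :
    ∃ x y : X, ‖x‖ = 1 ∧ ‖y‖ = 1 ∧ ‖x - y‖ = ε ∧ ‖t • x + (1 - t) • y‖ ∈ C := by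
  have hX1 : 1 < Module.rank ℝ X := lt_of_lt_of_le (by norm_num) hX
  have : Nontrivial X := rank_pos_iff_nontrivial.1 (zero_lt_one.trans hX1)
  obtain ⟨a, ha⟩ := exists_ne (0 : X)
  obtain ⟨b, hab⟩ := exists_linearIndependent_pair_of_one_lt_rank hX1 ha
  obtain ⟨x, y, hx, hy, hxy, hz⟩ := (planeSeminorm a b).exists_pair_of_regular
    (fun v hv => by
      rw [planeSeminorm_apply, norm_pos_iff]
      intro h0
      obtain ⟨h1, h2⟩ := LinearIndependent.pair_iff.1 hab v.re v.im h0
      exact hv (Complex.ext h1 h2)) hC h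
  rw [planeSeminorm_apply] at hx hy hxy hz
  refine ⟨_, _, hx, hy, ?_, ?_⟩
  · rw [norm_sub_rev, ← hxy, Complex.sub_re, Complex.sub_im]
    congr 1
    module
  · convert hz using 2
    simp only [Complex.add_re, Complex.add_im, Complex.smul_re, Complex.smul_im, smul_eq_mul]
    module

/-- It suffices to find chords for regular norms and `ε`, `t` in the interior of their ranges. -/
theorem exists_chord (hX : 2 ≤ Module.rank ℝ X) {ε t : ℝ} (hε : ε ∈ Set.Icc (0 : ℝ) 2)
    (ht : t ∈ Set.Icc (0 : ℝ) 1) {C : Set ℝ} (hC : IsClosed C)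
    (hr : Real.sqrt (1 - t * (1 - t) * ε ^ 2) ∈ C)
    (h : 0 < t → t < 1 → 0 < ε → ε < 2 → ∀ S : RegularPlaneNorm,
      ∃ x y, S.M x = 1 ∧ S.M y = 1 ∧ S.M (y - x) = ε ∧ S.M (t • x + (1 - t) • y) ∈ C) :
    ∃ x y : X, ‖x‖ = 1 ∧ ‖y‖ = 1 ∧ ‖x - y‖ = ε ∧ ‖t • x + (1 - t) • y‖ ∈ C := by
  have : Nontrivial X := rank_pos_iff_nontrivial.1 (lt_of_lt_of_le (by norm_num) hX)
  obtain ⟨u, hu⟩ := exists_norm_eq X zero_le_one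
  rcases hε.1.eq_or_lt with rfl | hε0
  · refine ⟨u, u, hu, hu, by simp, ?_⟩
    rw [← add_smul, add_sub_cancel, one_smul, hu]
    simpa using hr
  rcases hε.2.eq_or_lt with rfl | hε2
  · refine ⟨u, -u, hu, by rw [norm_neg, hu], ?_, ?_⟩
    · have : u - -u = (2 : ℝ) • u := by module
      rw [this, norm_smul, hu]; norm_num
    · have h1 : t • u + (1 - t) • -u = (2 * t - 1) • u := by module
      have h2 : 1 - t * (1 - t) * 2 ^ 2 = (2 * t - 1) ^ 2 := by ring
      rw [h2, Real.sqrt_sq_eq_abs] at hr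
      rw [h1, norm_smul, hu, mul_one]
      exact hr
  by_cases htt : 0 < t ∧ t < 1
  · exact exists_chord_of_regular hX hC (h htt.1 htt.2 hε0 hε2)
  -- For `t = 0` or `t = 1` the dividing point is an endpoint, so any chord of length `ε` serves; `1
  -- / 2` is an arbitrary interior parameter.
  · obtain ⟨x, y, hx, hy, hxy, -⟩ := exists_chord_of_regular (X := X) (ε := ε) (t := 1 / 2) hX
      isClosed_Iic fun S => S.exists_pair_le (by norm_num) (by norm_num) hε0 hε2
    refine ⟨x, y, hx, hy, hxy, ?_⟩
    have ht' : t = 0 ∨ t = 1 := by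
      rcases ht.1.eq_or_lt with h0 | h0
      · exact Or.inl h0.symm
      · exact Or.inr (le_antisymm ht.2 (not_lt.1 fun h1 => htt ⟨h0, h1⟩))
    rcases ht' with rfl | rfl
    · simpa [hy] using hr
    · simpa [hx] using hr

theorem genConvexityModulus_le (hX : 2 ≤ Module.rank ℝ X) {ε t : ℝ}
    (hε : ε ∈ Set.Icc (0 : ℝ) 2) (ht : t ∈ Set.Icc (0 : ℝ) 1) :
    genConvexityModulus X ε t ≤ 1 - Real.sqrt (1 - t * (1 - t) * ε ^ 2) := by
  obtain ⟨x, y, hx, hy, hxy, hz⟩ := exists_chord hX hε ht isClosed_Ici Set.self_mem_Ici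
    fun ht0 ht1 hε0 hε2 S => S.exists_pair_ge ht0 ht1 hε0 hε2
  have hbdd : BddBelow (chordDefects X ε t) := by
    refine ⟨0, ?_⟩
    rintro _ ⟨x, y, hx, hy, -, rfl⟩
    have h := norm_add_le (t • x) ((1 - t) • y)
    rw [norm_smul, norm_smul, hx, hy, Real.norm_of_nonneg ht.1,
      Real.norm_of_nonneg (sub_nonneg.2 ht.2)] at h
    linarith
  exact (csInf_le hbdd ⟨x, y, hx, hy, hxy, rfl⟩).trans (sub_le_sub_left hz 1)

theorem le_genBanasModulus (hX : 2 ≤ Module.rank ℝ X) {ε t : ℝ}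
    (hε : ε ∈ Set.Icc (0 : ℝ) 2) (ht : t ∈ Set.Icc (0 : ℝ) 1) :
    1 - Real.sqrt (1 - t * (1 - t) * ε ^ 2) ≤ genBanasModulus X ε t := by
  obtain ⟨x, y, hx, hy, hxy, hz⟩ := exists_chord hX hε ht isClosed_Iic Set.self_mem_Iic
    fun ht0 ht1 hε0 hε2 S => S.exists_pair_le ht0 ht1 hε0 hε2
  have hbdd : BddAbove (chordDefects X ε t) := by
    refine ⟨1, ?_⟩
    rintro _ ⟨x, y, -, -, -, rfl⟩
    linarith [norm_nonneg (t • x + (1 - t) • y)]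
  exact (sub_le_sub_left hz 1).trans (le_csSup hbdd ⟨x, y, hx, hy, hxy, rfl⟩)

end NormedSpace

/-! ### Hilbert spaces and the conclusion -/

theorem chordDefects_eq_singleton {H : Type*} [NormedAddCommGroup H] [InnerProductSpace ℝ H]
    (hH : 2 ≤ Module.rank ℝ H) {ε t : ℝ} (hε : ε ∈ Set.Icc (0 : ℝ) 2)
    (ht : t ∈ Set.Icc (0 : ℝ) 1) :
    chordDefects H ε t = {1 - Real.sqrt (1 - t * (1 - t) * ε ^ 2)} := by
  have hsub : ∀ r ∈ chordDefects H ε t, r = 1 - Real.sqrt (1 - t * (1 - t) * ε ^ 2) := by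
    rintro _ ⟨x, y, hx, hy, hxy, rfl⟩
    have h1 := norm_sub_sq_real x y
    have h2 := norm_add_sq_real (t • x) ((1 - t) • y)
    rw [hx, hy, hxy] at h1
    rw [norm_smul, norm_smul, hx, hy, inner_smul_left, inner_smul_right, mul_one, mul_one,
      Real.norm_eq_abs, Real.norm_eq_abs, sq_abs, sq_abs, RCLike.conj_to_real] at h2
    have h3 : ‖t • x + (1 - t) • y‖ ^ 2 = 1 - t * (1 - t) * ε ^ 2 := by
      rw [h2, h1]; ring
    rw [← h3, Real.sqrt_sq (norm_nonneg _)]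
  refine Set.eq_singleton_iff_nonempty_unique_mem.2 ⟨?_, hsub⟩
  -- Only the existence of a chord of length `ε` is needed here; the bound on its dividing point is
  -- discarded.
  obtain ⟨x, y, hx, hy, hxy, -⟩ := exists_chord hH hε ht isClosed_Iic Set.self_mem_Iic
    fun ht0 ht1 hε0 hε2 S => S.exists_pair_le ht0 ht1 hε0 hε2
  exact ⟨_, x, y, hx, hy, hxy, rfl⟩

theorem mainTheorem3
    {X : Type*} [NormedAddCommGroup X] [NormedSpace ℝ X] [CompleteSpace X]
    {H : Type*} [NormedAddCommGroup H] [InnerProductSpace ℝ H] [CompleteSpace H]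
    (hX : 2 ≤ Module.rank ℝ X) (hH : 2 ≤ Module.rank ℝ H)
    (ε t : ℝ) (hε : ε ∈ Set.Icc (0 : ℝ) 2) (ht : t ∈ Set.Icc (0 : ℝ) 1) :
    genConvexityModulus X ε t ≤ genConvexityModulus H ε t ∧
    genConvexityModulus H ε t = 1 - Real.sqrt (1 - t * (1 - t) * ε ^ 2) ∧
    1 - Real.sqrt (1 - t * (1 - t) * ε ^ 2) = genBanasModulus H ε t ∧
    genBanasModulus H ε t ≤ genBanasModulus X ε t := by
  have h1 : genConvexityModulus H ε t = 1 - Real.sqrt (1 - t * (1 - t) * ε ^ 2) := by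
    rw [genConvexityModulus, chordDefects_eq_singleton hH hε ht, csInf_singleton]
  have h2 : genBanasModulus H ε t = 1 - Real.sqrt (1 - t * (1 - t) * ε ^ 2) := by
    rw [genBanasModulus, chordDefects_eq_singleton hH hε ht, csSup_singleton]
  exact ⟨h1 ▸ genConvexityModulus_le hX hε ht, h1, h2.symm, h2 ▸ le_genBanasModulus hX hε ht⟩
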